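/- Let $\log^* x = 1$ for $x \le 1$ and $\log^* x = 1 + \log^*(\log_2 x)$ for $x>1$. Let $G=(V,E)$ be a path or line (a connected acyclic graph of maximum degree at most $2$, finite or infinite) whose nodes carry distinct identifiers $\ell(v)\in\{1,2,\dots\}$. Let $U\subseteq V$ be finite, and let $R\ge 1$ be an integer. A set $S$ is a $U$-limited $(\alpha,\beta)$-ruling set of $G$ if $S\subseteq U$, any two distinct nodes of $S$ are at distance at least $\alpha$ in $G$, and every node of $U$ is at distance at most $\beta$ in $G$ from some node of $S$. For $k\ge 1$, $G^k$ is the graph on $V$ in which two nodes are adjacent if their distance in $G$ lies in $\{1,\dots,k\}$. The algorithm PathRulingSet works as follows. Let $d=\lceil\log_2 R\rceil$ and $S_0=U$. For $i=1,\dots,d$, let $R_i=2^i-1$ if $i\le d-1$ and $R_d=R-1$, and let $S_i$ be the node set of a maximal independent set of the induced subgraph $G^{R_i}[S_{i-1}]$. Put $S_{\mathrm{out}}=S_d$. Then do the following $6$ times: for $v\in U$ let $b_v=\min_{u\in S_{\mathrm{out}}}\operatorname{dist}(v,u)$, let $U_{\mathrm{cand}}=\{v\in U: b_v\ge R\}$,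 and add to $S_{\mathrm{out}}$ all $v\in U_{\mathrm{cand}}$ such that every $u\in U_{\mathrm{cand}}\setminus\{v\}$ with $\operatorname{dist}(u,v)\le R-1$ satisfies $b_u<b_v$, or $b_u=b_v$ and $\ell(u)<\ell(v)$. Return $S_{\mathrm{out}}$. Lemma. (1) For every choice of the maximal independent sets, PathRulingSet returns a $U$-limited $(R,R-1)$-ruling set of $G$. (2) PathRulingSet can be executed in $O(R\log^* n)$ rounds of the deterministic LOCAL model: there are a universal constant $C$ and, for all integers $n\ge 0$ and $R\ge 1$, a deterministic LOCAL algorithm $A_{n,R}$ such that for all $G$, $\ell$ and $U$ as above with $\ell(v)\le n$ for all $v\in U$, if every node $v$ initially knows only $\ell(v)$ and whether $v\in U$, then all nodes of $G$ terminate within $C\,R\log^* n$ rounds of $A_{n,R}$, and the set $S$ of the nodes that output "in the set" is returned by some execution of PathRulingSet (in particular, $S$ is a $U$-limited $(R,R-1)$-ruling set of $G$). -/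

import Mathlib

/-! ### The iterated logarithm -/

/-- `log* x`, normalised so that `log* x = 1` for `x ≤ 1` and `log* x = 1 + log* (log₂ x)` for
`x > 1`: one plus the number of times `log₂` has to be applied to `x` to reach a value `≤ 1`.
The two equations are `logStar_of_le` and `logStar_of_lt` below. -/
noncomputable def logStar (x : ℝ) : ℕ :=
  1 + sInf {k : ℕ | (Real.logb 2)^[k] x ≤ 1}

theorem logStar_of_le {x : ℝ} (hx : x ≤ 1) : logStar x = 1 := by
  simpa [logStar] using Or.inl hx

theorem exists_iterate_logb_le_one (x : ℝ) : ∃ k : ℕ, (Real.logb 2)^[k] x ≤ 1 := by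
  have key : ∀ (m : ℕ) (y : ℝ), y ≤ m + 1 → ∃ k : ℕ, (Real.logb 2)^[k] y ≤ 1 := by
    intro m
    induction m with
    | zero => intro y hy; exact ⟨0, by simpa using hy⟩
    | succ m ih =>
      intro y hy
      by_cases h1 : y ≤ 1
      · exact ⟨0, by simpa using h1⟩
      push Not at h1
      have hlog : Real.logb 2 y ≤ m + 1 := by
        rw [Real.logb_le_iff_le_rpow (by norm_num) (by linarith)]
        have h2 : ((m : ℝ) + 1) + 1 ≤ 2 ^ (m + 1) := by
          exact_mod_cast Nat.succ_le_of_lt (Nat.lt_two_pow_self (n := m + 1))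
        have h3 : (2 : ℝ) ^ ((m : ℝ) + 1) = 2 ^ (m + 1) := by
          exact_mod_cast Real.rpow_natCast 2 (m + 1)
        rw [h3]
        push_cast at hy
        linarith
      obtain ⟨k, hk⟩ := ih _ hlog
      exact ⟨k + 1, by simpa using hk⟩
  obtain ⟨m, hm⟩ := exists_nat_ge x
  exact key m x (by linarith)

theorem logStar_of_lt {x : ℝ} (hx : 1 < x) : logStar x = 1 + logStar (Real.logb 2 x) := by
  have h : sInf {k : ℕ | (Real.logb 2)^[k + 1] x ≤ 1} + 1
      = sInf {k : ℕ | (Real.logb 2)^[k] x ≤ 1} := by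
    refine Nat.sInf_add (p := fun k : ℕ => (Real.logb 2)^[k] x ≤ 1) (n := 1) ?_
    apply Nat.one_le_iff_ne_zero.2
    intro h0
    rcases Nat.sInf_eq_zero.1 h0 with h1 | h1
    · exact absurd h1 (by simpa using hx)
    · obtain ⟨k, hk⟩ := exists_iterate_logb_le_one x
      exact absurd hk (Set.eq_empty_iff_forall_notMem.1 h1 k)
  simp only [Function.iterate_succ_apply] at h
  simp only [logStar]
  omega

/-! ### Graph notions -/

/-- A path or a line: a connected graph without cycles in which all degrees are at most two
(finite paths, the infinite half-line, and the infinite line). -/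
structure IsPathOrLine {V : Type*} (G : SimpleGraph V) : Prop where
  connected : G.Connected
  acyclic : G.IsAcyclic
  degree_le : ∀ v, (G.neighborSet v).encard ≤ 2

/-- The power graph `G ^ k`: distinct nodes are adjacent when their distance is at most `k`. -/
def powerGraph {V : Type*} (G : SimpleGraph V) (k : ℕ) : SimpleGraph V where
  Adj u v := 1 ≤ G.edist u v ∧ G.edist u v ≤ k
  symm := ⟨fun u v h => by rwa [SimpleGraph.edist_comm]⟩
  loopless := ⟨fun v h => by simp at h⟩

/-- Maximal independent sets: independent and dominating. -/
structure IsMIS {W : Type*} (H : SimpleGraph W) (M : Set W) : Prop where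
  independent : ∀ u ∈ M, ∀ v ∈ M, ¬ H.Adj u v
  dominating : ∀ u, u ∉ M → ∃ v ∈ M, H.Adj u v

/-- `S` is a `U`-limited `(α, β)`-ruling set of `G`; all distances are taken in `G`. -/
structure IsLimitedRulingSet {V : Type*} (G : SimpleGraph V) (U : Set V) (α β : ℕ) (S : Set V) :
    Prop where
  subset : S ⊆ U
  packing : ∀ u ∈ S, ∀ v ∈ S, u ≠ v → (α : ℕ∞) ≤ G.edist u v
  covering : ∀ u ∈ U, ∃ v ∈ S, G.edist u v ≤ β

/-! ### The algorithm PathRulingSet -/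

namespace PathRulingSet

/-- `⌈log₂ R⌉`, the number of MIS computations. -/
def depth (R : ℕ) : ℕ := Nat.clog 2 R

/-- The order of the power graph in iteration `i ∈ {1, …, depth R}`. -/
def radius (R i : ℕ) : ℕ := if i < depth R then 2 ^ i - 1 else R - 1

/-- `b_v`, the distance from `v` to the nearest node of `S`. -/
noncomputable def distTo {V : Type*} (G : SimpleGraph V) (S : Set V) (v : V) : ℕ∞ :=
  ⨅ u ∈ S, G.edist v u

/-- The candidates: nodes of `U` at distance at least `R` from `S`. -/
def candidates {V : Type*} (G : SimpleGraph V) (U : Set V) (R : ℕ) (S : Set V) : Set V :=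
  {v | v ∈ U ∧ (R : ℕ∞) ≤ distTo G S v}

/-- One iteration of the greedy extension: every candidate whose pair `(b_v, ℓ v)` is
lexicographically larger than that of all other candidates within distance `R - 1` joins. -/
def greedyStep {V : Type*} (G : SimpleGraph V) (ℓ : V → ℕ+) (U : Set V) (R : ℕ) (S : Set V) :
    Set V :=
  S ∪ {v | v ∈ candidates G U R S ∧
    ∀ u ∈ candidates G U R S, u ≠ v → G.edist v u ≤ ((R - 1 : ℕ) : ℕ∞) →
      distTo G S u < distTo G S v ∨ (distTo G S u = distTo G S v ∧ ℓ u < ℓ v)}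

/-- `Sout` is returned by some execution of PathRulingSet on `(U, R)`. The only freedom in an
execution is which maximal independent set of `G ^ (radius R i) [S_{i-1}]` is computed in each
iteration `i` of the first loop. -/
def IsOutput {V : Type*} (G : SimpleGraph V) (ℓ : V → ℕ+) (U : Set V) (R : ℕ) (Sout : Set V) :
    Prop :=
  ∃ S : ℕ → Set V, S 0 = U ∧
    (∀ i, i < depth R → ∃ M : Set (S i),
      IsMIS ((powerGraph G (radius R (i + 1))).induce (S i)) M ∧
        S (i + 1) = (fun x : S i => (x : V)) '' M) ∧
    Sout = (greedyStep G ℓ U R)^[6] (S (depth R))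

end PathRulingSet

/-! ### Deterministic LOCAL -/

/-- A deterministic algorithm in the LOCAL model, for nodes with initial local input in `In`
and outputs in `Out`. Local computation and message size are unrestricted. In each round a node
broadcasts one message to its neighbours and receives the multiset of the messages of its
neighbours. (Messages are unbounded and may carry identifiers, so this is no loss against
separate messages for separate neighbours, and it is a special case of the latter.) A node has
terminated once `output` is defined on its state. -/
structure LocalAlgorithm (In Out : Type) where
  State : Type
  Msg : Type
  init : In → State
  send : State → Msg
  receive : State → Multiset Msg → State
  output : State → Option Out

namespace LocalAlgorithm

/-- The state of each node after `t` synchronous rounds on the graph `G`. Nodes that have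
terminated keep their state and fall silent. -/
def run {In Out : Type} (A : LocalAlgorithm In Out) {V : Type*} (G : SimpleGraph V)
    [G.LocallyFinite] (input : V → In) : ℕ → V → A.State
  | 0, v => A.init (input v)
  | t + 1, v =>
    if (A.output (run A G input t v)).isSome then run A G input t v
    else A.receive (run A G input t v)
      ((G.neighborFinset v).val.filterMap fun u =>
        if (A.output (run A G input t u)).isSome then none
        else some (A.send (run A G input t u)))

end LocalAlgorithm

open Classical in
/-- The initial local input of a node: its identifier and whether it belongs to `U`. -/
noncomputable def localInput {V : Type*} (ℓ : V → ℕ+) (U : Set V) (v : V) : ℕ+ × Bool :=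
  (ℓ v, decide (v ∈ U))

open Classical in
/-- Within `T` rounds every node terminates, with output `true` exactly at the nodes of `S`. -/
def LocalAlgorithm.ComputesWithin (A : LocalAlgorithm (ℕ+ × Bool) Bool) {V : Type*}
    (G : SimpleGraph V) [G.LocallyFinite] (ℓ : V → ℕ+) (U S : Set V) (T : ℕ) : Prop :=
  ∀ v, A.output (A.run G (localInput ℓ U) T v) = some (decide (v ∈ S))

/-! ### Paths and lines embed isometrically into the integers -/

namespace SimpleGraph

variable {V : Type*} {G : SimpleGraph V}

/-! A path or line embeds isometrically into ℤ (`IsPathOrLine.exists_isometry_int`), so metric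
claims become integer inequalities. Maximal independent sets of induced power graphs are limited
ruling sets (`exists_isMIS_induce_powerGraph_iff`), so the first loop is a chain of ruling sets.

Correctness: the last set S_d of the chain is R-separated, and the covering radii add up
geometrically to at most 3R - 1. Each greedy step adds a node in every gap of S_d that still holds a
candidate. A candidate surviving six steps would give seven nodes in one gap, pairwise at distance
at least R and each at distance in [R, 3R) from S_d. At either end of a gap only two such nodes fit,
a contradiction (`candidates_greedyStep_iterate_eq_empty`).

Round complexity: S_{i-1} is 2^(i-1)-separated and R_i < 2^i, so G^{R_i}[S_{i-1}] has maximum degree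
at most 2. An unoriented form of Cole–Vishkin bit reduction brings the identifiers down to at most
1024 in log* n - 1 steps (`reducedColouring_le`), and 1025 greedy steps over the colour classes give
the independent set. Each step needs radius R_i, and the radii sum to O(R).

No message protocol is written out: it is enough that membership in the output depends only on the
view of radius O(R log* n) (`PathInput.isLocal_rulingSet`), since a node can collect that view and
then decide. -/

theorem Connected.exists_adj_dist_add_one (hG : G.Connected) {r v : V} (h : v ≠ r) :
    ∃ u, G.Adj u v ∧ G.dist r v = G.dist r u + 1 := by
  obtain ⟨p, hp⟩ := hG.exists_walk_length_eq_dist v r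
  cases p with
  | nil => exact absurd rfl h
  | @cons _ u _ hadj q =>
    refine ⟨u, hadj.symm, ?_⟩
    have h1 : G.dist u r ≤ q.length := dist_le q
    have h2 : G.dist v r ≤ G.dist v u + G.dist u r := hG.dist_triangle
    rw [dist_eq_one_iff_adj.2 hadj] at h2
    rw [Walk.length_cons] at hp
    rw [dist_comm (u := r), dist_comm (u := r)]
    omega

/-- Two different predecessors would extend to two different paths from `r` to `v`, which acyclicity
excludes. -/
theorem IsTree.eq_of_adj_of_dist_add_one (hG : G.IsTree) {r u w v : V} (hu : G.Adj u v)
    (hw : G.Adj w v) (hdu : G.dist r v = G.dist r u + 1) (hdw : G.dist r v = G.dist r w + 1) :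
    u = w := by
  obtain ⟨p, hp⟩ := hG.connected.exists_walk_length_eq_dist r u
  obtain ⟨q, hq⟩ := hG.connected.exists_walk_length_eq_dist r w
  have hp' : (p.concat hu).IsPath :=
    Walk.isPath_of_length_eq_dist _ (by rw [Walk.length_concat]; omega)
  have hq' : (q.concat hw).IsPath :=
    Walk.isPath_of_length_eq_dist _ (by rw [Walk.length_concat]; omega)
  have h := congrArg Subtype.val ((hG.isAcyclic.subsingleton_path r v).elim ⟨_, hp'⟩ ⟨_, hq'⟩)
  simpa using congrArg Walk.penultimate h

end SimpleGraph

namespace IsPathOrLine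

variable {V : Type*} {G : SimpleGraph V}

theorem isTree (hG : IsPathOrLine G) : G.IsTree := ⟨hG.connected, hG.acyclic⟩

theorem eq_of_adj_of_adj (hG : IsPathOrLine G) {v a b c : V} (ha : G.Adj v a) (hb : G.Adj v b)
    (hc : G.Adj v c) (hab : a ≠ b) (hac : a ≠ c) : b = c := by
  by_contra hbc
  have h : ({a, b, c} : Set V) ⊆ G.neighborSet v := by
    rintro x (rfl | rfl | rfl) <;> assumption
  have h3 : ({a, b, c} : Set V).encard = 3 := by
    rw [Set.encard_eq_three]
    exact ⟨a, b, c, hab, hac, hbc, rfl⟩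
  have := (Set.encard_le_encard h).trans (hG.degree_le v)
  rw [h3] at this
  exact absurd this (by decide)

/-- The nodes on the side of `a`, as seen from `r`. -/
def Side (G : SimpleGraph V) (r a v : V) : Prop := G.dist a v < G.dist r v

/-- The predecessor `w` of `v` towards `a` is also a predecessor towards `r`, and the latter is
unique, so `w = u`. The case `u = r` has to be excluded because both sides start there. -/
theorem side_iff_of_adj (hG : IsPathOrLine G) {r a u v : V} (ha : G.Adj r a) (hu : u ≠ r)
    (hadj : G.Adj u v) (hd : G.dist r v = G.dist r u + 1) : Side G r a u ↔ Side G r a v := by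
  have h1 : ∀ x, G.dist r x ≤ G.dist a x + 1 := fun x => by
    have := hG.connected.dist_triangle (u := r) (v := a) (w := x)
    rw [SimpleGraph.dist_eq_one_iff_adj.2 ha] at this
    omega
  have h2 : G.dist a v ≤ G.dist a u + 1 := by
    have := hG.connected.dist_triangle (u := a) (v := u) (w := v)
    rwa [SimpleGraph.dist_eq_one_iff_adj.2 hadj] at this
  unfold Side
  constructor
  · intro h; omega
  · intro h
    have hva : v ≠ a := by
      rintro rfl
      rw [SimpleGraph.dist_eq_one_iff_adj.2 ha] at hd
      have : G.dist r u = 0 := by omega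
      exact hu (hG.connected.dist_eq_zero_iff.1 this).symm
    obtain ⟨w, hw, hwd⟩ := hG.connected.exists_adj_dist_add_one hva
    have := h1 w
    have h4 := h1 v
    have hrw : G.dist r v = G.dist r w + 1 := by
      have := hG.connected.dist_triangle (u := r) (v := w) (w := v)
      rw [SimpleGraph.dist_eq_one_iff_adj.2 hw] at this
      omega
    have := hG.isTree.eq_of_adj_of_dist_add_one hadj hw hd hrw
    subst this
    omega

/-- Each side is a single ray: a node other than `r` already has its predecessor as a neighbour, so
the degree bound leaves at most one neighbour further out. -/
theorem eq_of_side_of_dist (hG : IsPathOrLine G) {r a : V} (ha : G.Adj r a) (k : ℕ) :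
    ∀ u v, G.dist r u = k + 1 → G.dist r v = k + 1 → (Side G r a u ↔ Side G r a v) → u = v := by
  induction k with
  | zero =>
    intro u v hu hv hs
    have hau : ∀ x, G.dist r x = 0 + 1 → (Side G r a x ↔ x = a) := fun x hx => by
      unfold Side
      rw [hx, Nat.lt_one_iff, hG.connected.dist_eq_zero_iff, eq_comm]
    rw [hau u hu, hau v hv] at hs
    by_cases h : u = a
    · rw [h, hs.1 h]
    · exact hG.eq_of_adj_of_adj ha (SimpleGraph.dist_eq_one_iff_adj.1 hu)
        (SimpleGraph.dist_eq_one_iff_adj.1 hv) (Ne.symm h) (fun h' => h (hs.2 h'.symm))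
  | succ k ih =>
    intro u v hu hv hs
    have hne : ∀ x, G.dist r x ≠ 0 → x ≠ r := fun x hx h => hx (by simp [h])
    obtain ⟨u', hu', hdu⟩ := hG.connected.exists_adj_dist_add_one (hne u (by omega))
    obtain ⟨v', hv', hdv⟩ := hG.connected.exists_adj_dist_add_one (hne v (by omega))
    have hnu := hne u' (by omega)
    have : u' = v' := by
      refine ih u' v' (by omega) (by omega) ?_
      rw [hG.side_iff_of_adj ha hnu hu' hdu, hs,
        hG.side_iff_of_adj ha (hne v' (by omega)) hv' hdv]
    subst this
    obtain ⟨p, hp, hdp⟩ := hG.connected.exists_adj_dist_add_one hnu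
    refine hG.eq_of_adj_of_adj hp.symm hu' hv' ?_ ?_ <;> rintro rfl <;> omega

theorem exists_ancestor (hG : IsPathOrLine G) {r a : V} (ha : G.Adj r a) (v : V) (j m : ℕ)
    (h : G.dist r v = j + 1 + m) :
    ∃ u, G.dist r u = j + 1 ∧ (Side G r a u ↔ Side G r a v) ∧ G.dist u v ≤ m := by
  induction m generalizing v with
  | zero => exact ⟨v, h, Iff.rfl, by simp⟩
  | succ m ih =>
    have hne : ∀ x, G.dist r x ≠ 0 → x ≠ r := fun x hx h => hx (by simp [h])
    obtain ⟨w, hw, hd⟩ := hG.connected.exists_adj_dist_add_one (hne v (by omega))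
    obtain ⟨u, hu, hs, hm⟩ := ih w (by omega)
    refine ⟨u, hu, hs.trans (hG.side_iff_of_adj ha (hne w (by omega)) hw hd), ?_⟩
    have := hG.connected.dist_triangle (u := u) (v := w) (w := v)
    rw [SimpleGraph.dist_eq_one_iff_adj.2 hw] at this
    omega

open Classical in
/-- Signed distance from `r`, positive on the side of `a`. -/
noncomputable def signedDist (G : SimpleGraph V) (r a v : V) : ℤ :=
  if Side G r a v then G.dist r v else - G.dist r v

theorem natAbs_signedDist_sub_of_adj (hG : IsPathOrLine G) {r a : V} (ha : G.Adj r a) {u v : V}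
    (h : G.Adj u v) : (signedDist G r a u - signedDist G r a v).natAbs ≤ 1 := by
  wlog hd : G.dist r v = G.dist r u + 1 generalizing u v
  · have := this h.symm
      ((hG.isTree.dist_eq_dist_add_one_of_adj r h).resolve_right hd)
    omega
  by_cases hu : u = r
  · subst hu
    simp only [signedDist, SimpleGraph.dist_self] at hd ⊢
    split_ifs <;> omega
  · have := hG.side_iff_of_adj ha hu h hd
    by_cases hs : Side G r a v
    · simp only [signedDist, hs, this.2 hs, if_true]
      omega
    · simp only [signedDist, hs, mt this.1 hs, if_false]
      omega

theorem natAbs_signedDist_sub_le (hG : IsPathOrLine G) {r a : V} (ha : G.Adj r a) (u v : V) :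
    (signedDist G r a u - signedDist G r a v).natAbs ≤ G.dist u v := by
  obtain ⟨p, hp⟩ := hG.connected.exists_walk_length_eq_dist u v
  rw [← hp]
  clear hp
  induction p with
  | nil => simp
  | cons h p ih =>
    have := hG.natAbs_signedDist_sub_of_adj ha h
    rw [SimpleGraph.Walk.length_cons]
    omega

theorem dist_le_natAbs_signedDist_sub (hG : IsPathOrLine G) {r a : V} (ha : G.Adj r a) (u v : V) :
    G.dist u v ≤ (signedDist G r a u - signedDist G r a v).natAbs := by
  wlog hle : G.dist r u ≤ G.dist r v generalizing u v
  · have := this v u (by omega)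
    rw [SimpleGraph.dist_comm]
    omega
  have htri := hG.connected.dist_triangle (u := u) (v := r) (w := v)
  rw [SimpleGraph.dist_comm (u := u) (v := r)] at htri
  by_cases hu : G.dist r u = 0
  · simp only [signedDist]
    split_ifs <;> omega
  -- On one side, `u` is the ancestor of `v` at its level; on opposite sides, the triangle
  -- inequality through `r` is the required bound.
  by_cases hs : Side G r a u ↔ Side G r a v
  · obtain ⟨w, hw, hws, hwd⟩ := hG.exists_ancestor ha v (G.dist r u - 1)
      (G.dist r v - G.dist r u) (by omega)
    have : u = w := hG.eq_of_side_of_dist ha (G.dist r u - 1) u w (by omega) hw (hs.trans hws.symm)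
    subst this
    by_cases h : Side G r a v
    · simp only [signedDist, h, hs.2 h, if_true]
      omega
    · simp only [signedDist, h, mt hs.1 h, if_false]
      omega
  · by_cases h1 : Side G r a u <;> by_cases h2 : Side G r a v <;>
      simp only [h1, h2, not_true_eq_false, iff_self, not_false_eq_true, iff_true, iff_false]
        at hs
    all_goals
      simp only [signedDist, h1, h2, if_true, if_false]
      omega

/-- A path or line embeds isometrically into the integers. -/
theorem exists_isometry_int (hG : IsPathOrLine G) :
    ∃ pos : V → ℤ, ∀ u v, G.edist u v = ((pos u - pos v).natAbs : ℕ∞) := by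
  obtain ⟨r⟩ := hG.connected.nonempty
  by_cases h : ∃ a, G.Adj r a
  · obtain ⟨a, ha⟩ := h
    refine ⟨signedDist G r a, fun u v => ?_⟩
    rw [← (hG.connected u v).coe_dist_eq_edist]
    exact congrArg _ (le_antisymm (hG.dist_le_natAbs_signedDist_sub ha u v)
      (hG.natAbs_signedDist_sub_le ha u v))
  · have hr : ∀ v, v = r := fun v => by
      obtain ⟨p⟩ := hG.connected r v
      cases p with
      | nil => rfl
      | cons hadj _ => exact absurd ⟨_, hadj⟩ h
    exact ⟨fun _ => 0, fun u v => by simp [hr u, hr v]⟩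

end IsPathOrLine

/-! ### Correctness of PathRulingSet -/

/-- Maximal independent sets of an induced power graph are limited ruling sets. -/
theorem exists_isMIS_induce_powerGraph_iff {V : Type*} {G : SimpleGraph V} {r : ℕ} {S T : Set V} :
    (∃ M : Set S, IsMIS ((powerGraph G r).induce S) M ∧ T = (fun x : S => (x : V)) '' M) ↔
      IsLimitedRulingSet G S (r + 1) r T := by
  have key : ∀ u v : V, u ≠ v → (¬ (powerGraph G r).Adj u v ↔ ((r + 1 : ℕ) : ℕ∞) ≤ G.edist u v) := by
    intro u v huv
    have h1 : 1 ≤ G.edist u v :=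
      Order.one_le_iff_pos.2 (SimpleGraph.edist_pos_of_ne huv)
    simp only [powerGraph, h1, true_and, not_le]
    rw [Nat.cast_add, Nat.cast_one, ENat.add_one_le_iff (ENat.natCast_ne_top r)]
  constructor
  · rintro ⟨M, hM, rfl⟩
    refine ⟨?_, ?_, ?_⟩
    · rintro _ ⟨x, _, rfl⟩
      exact x.2
    · rintro _ ⟨x, hx, rfl⟩ _ ⟨y, hy, rfl⟩ hxy
      exact (key _ _ hxy).1 (hM.independent x hx y hy)
    · intro u hu
      by_cases h : (⟨u, hu⟩ : S) ∈ M
      · exact ⟨u, ⟨_, h, rfl⟩, by simp⟩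
      · obtain ⟨v, hv, hadj⟩ := hM.dominating _ h
        exact ⟨v, ⟨v, hv, rfl⟩, hadj.2⟩
  · intro h
    refine ⟨{x | (x : V) ∈ T}, ⟨?_, ?_⟩, ?_⟩
    · intro u hu v hv hadj
      have hne : (u : V) ≠ v := fun h => hadj.ne (Subtype.ext h)
      exact (key _ _ hne).2 (h.packing _ hu _ hv hne) hadj
    · intro u hu
      obtain ⟨v, hv, hd⟩ := h.covering u u.2
      refine ⟨⟨v, h.subset hv⟩, hv, ?_, hd⟩
      have hne : (u : V) ≠ v := by
        rintro rfl
        exact hu hv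
      exact Order.one_le_iff_pos.2 (SimpleGraph.edist_pos_of_ne hne)
    · ext x
      simp only [Set.mem_image, Set.mem_ofPred_eq, Subtype.exists, exists_and_left, exists_prop,
        exists_eq_right_right]
      exact ⟨fun hx => ⟨hx, h.subset hx⟩, fun hx => hx.1⟩

namespace PathRulingSet

variable {V : Type*} {G : SimpleGraph V} {ℓ : V → ℕ+} {U : Set V} {R : ℕ}

/-- The first `k` sets of an execution of the first loop. -/
def IsRulingChain (G : SimpleGraph V) (U : Set V) (R : ℕ) (S : ℕ → Set V) (k : ℕ) : Prop :=
  S 0 = U ∧ ∀ i < k,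
    IsLimitedRulingSet G (S i) (radius R (i + 1) + 1) (radius R (i + 1)) (S (i + 1))

theorem isOutput_iff {T : Set V} :
    IsOutput G ℓ U R T ↔ ∃ S : ℕ → Set V, IsRulingChain G U R S (depth R) ∧
      T = (greedyStep G ℓ U R)^[6] (S (depth R)) := by
  simp only [IsOutput, IsRulingChain, exists_isMIS_induce_powerGraph_iff, and_assoc]

/-! ### First loop: separation and covering radius. -/

theorem radius_lt_two_pow {i : ℕ} (hi : i < depth R) : radius R (i + 1) < 2 ^ (i + 1) := by
  unfold radius
  split_ifs with h
  · have := Nat.two_pow_pos (i + 1)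
    omega
  · have hd : depth R = i + 1 := by omega
    have : R ≤ 2 ^ depth R := Nat.le_pow_clog (by norm_num) R
    rw [← hd]
    have := Nat.two_pow_pos (depth R)
    omega

theorem two_pow_depth_le (hR : 2 ≤ R) : 2 ^ depth R ≤ 2 * (R - 1) := by
  have h1 : 2 ^ (depth R).pred < R := Nat.pow_pred_clog_lt_self (by norm_num) hR
  have h2 : 0 < depth R := Nat.clog_pos (by norm_num) hR
  obtain ⟨k, hk⟩ : ∃ k, depth R = k + 1 := ⟨depth R - 1, by omega⟩
  rw [hk] at h1 ⊢
  rw [Nat.pred_succ] at h1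
  rw [pow_succ]
  omega

namespace IsRulingChain

variable {S : ℕ → Set V} {k : ℕ}

theorem mono (h : IsRulingChain G U R S k) {j : ℕ} (hj : j ≤ k) : IsRulingChain G U R S j :=
  ⟨h.1, fun i hi => h.2 i (hi.trans_le hj)⟩

theorem subset (h : IsRulingChain G U R S k) : S k ⊆ U := by
  induction k with
  | zero => exact h.1.subset
  | succ k ih => exact (h.2 k k.lt_succ_self).subset.trans (ih (h.mono k.le_succ))

theorem packing_of_lt_depth (h : IsRulingChain G U R S k) (hk : k < depth R) {u v : V}
    (hu : u ∈ S k) (hv : v ∈ S k) (huv : u ≠ v) : ((2 ^ k : ℕ) : ℕ∞) ≤ G.edist u v := by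
  cases k with
  | zero => simpa using Order.one_le_iff_pos.2 (SimpleGraph.edist_pos_of_ne huv)
  | succ k =>
    have := (h.2 k k.lt_succ_self).packing u hu v hv huv
    rw [radius, if_pos hk, Nat.sub_add_cancel Nat.one_le_two_pow] at this
    exact this

theorem packing (h : IsRulingChain G U R S (depth R)) {u v : V}
    (hu : u ∈ S (depth R)) (hv : v ∈ S (depth R)) (huv : u ≠ v) : (R : ℕ∞) ≤ G.edist u v := by
  rcases Nat.eq_zero_or_pos (depth R) with h0 | h0
  · have hR : R ≤ 1 := by
      have : R ≤ 2 ^ depth R := Nat.le_pow_clog (by norm_num) R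
      rwa [h0] at this
    exact le_trans (by exact_mod_cast hR)
      (Order.one_le_iff_pos.2 (SimpleGraph.edist_pos_of_ne huv))
  · obtain ⟨k, hk⟩ : ∃ k, depth R = k + 1 := ⟨depth R - 1, by omega⟩
    rw [hk] at hu hv
    have := (h.2 k (by omega)).packing u hu v hv huv
    rw [radius, if_neg (by omega)] at this
    exact le_trans (by exact_mod_cast (by omega : R ≤ R - 1 + 1)) this

/-- The radii 2^i - 1 for i ≤ k sum to at most 2^(k+1) - 2. -/
theorem covering_of_lt_depth (h : IsRulingChain G U R S k) (hk : k < depth R) {u : V}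
    (hu : u ∈ U) : ∃ v ∈ S k, G.edist u v ≤ ((2 ^ (k + 1) - 2 : ℕ) : ℕ∞) := by
  induction k with
  | zero => exact ⟨u, h.1 ▸ hu, by simp⟩
  | succ k ih =>
    obtain ⟨v, hv, hd⟩ := ih (h.mono k.le_succ) (by omega)
    obtain ⟨w, hw, hd'⟩ := (h.2 k k.lt_succ_self).covering v hv
    refine ⟨w, hw, SimpleGraph.edist_triangle.trans ((add_le_add hd hd').trans ?_)⟩
    have := radius_lt_two_pow (R := R) (i := k) (by omega)
    have h2 : 2 ≤ 2 ^ (k + 1) := by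
      rw [pow_succ]; have := Nat.two_pow_pos k; omega
    have : 2 ^ (k + 1) - 2 + radius R (k + 1) ≤ 2 ^ (k + 1 + 1) - 2 := by
      rw [pow_succ 2 (k + 1)]; omega
    exact_mod_cast this

theorem covering (h : IsRulingChain G U R S (depth R)) (hR : 1 ≤ R) {u : V} (hu : u ∈ U) :
    ∃ v ∈ S (depth R), G.edist u v ≤ ((3 * R - 1 : ℕ) : ℕ∞) := by
  rcases Nat.eq_zero_or_pos (depth R) with h0 | h0
  · refine ⟨u, ?_, by simp⟩
    rw [h0, h.1]
    exact hu
  · have hR2 : 2 ≤ R := by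
      by_contra hlt
      have : depth R = 0 := Nat.clog_of_right_le_one (by omega) 2
      omega
    have hpow := two_pow_depth_le hR2
    obtain ⟨k, hk⟩ : ∃ k, depth R = k + 1 := ⟨depth R - 1, by omega⟩
    obtain ⟨v, hv, hd⟩ := (h.mono (show k ≤ depth R by omega)).covering_of_lt_depth (by omega) hu
    obtain ⟨w, hw, hd'⟩ := (h.2 k (by omega)).covering v hv
    refine ⟨w, hk ▸ hw, SimpleGraph.edist_triangle.trans ((add_le_add hd hd').trans ?_)⟩
    rw [radius, if_neg (by omega)]
    rw [hk] at hpow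
    have : 2 ^ (k + 1) - 2 + (R - 1) ≤ 3 * R - 1 := by omega
    exact_mod_cast this

end IsRulingChain

/-! ### Greedy extension: six steps exhaust the candidates. -/

theorem mem_candidates {S : Set V} {v : V} :
    v ∈ candidates G U R S ↔ v ∈ U ∧ ∀ u ∈ S, (R : ℕ∞) ≤ G.edist v u := by
  simp [candidates, distTo]

theorem subset_greedyStep (S : Set V) : S ⊆ greedyStep G ℓ U R S := Set.subset_union_left

theorem greedyStep_iterate_mono (S : Set V) :
    Monotone fun k => (greedyStep G ℓ U R)^[k] S :=
  monotone_nat_of_le_succ fun k => by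
    rw [Function.iterate_succ_apply']
    exact subset_greedyStep _

theorem greedyStep_subset {S : Set V} (hS : S ⊆ U) : greedyStep G ℓ U R S ⊆ U :=
  Set.union_subset hS fun _ hv => hv.1.1

theorem greedyStep_packing {S : Set V} (hR : 1 ≤ R)
    (hS : ∀ u ∈ S, ∀ v ∈ S, u ≠ v → (R : ℕ∞) ≤ G.edist u v) :
    ∀ u ∈ greedyStep G ℓ U R S, ∀ v ∈ greedyStep G ℓ U R S, u ≠ v → (R : ℕ∞) ≤ G.edist u v := by
  rintro u (hu | hu) v (hv | hv) huv
  · exact hS u hu v hv huv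
  · rw [SimpleGraph.edist_comm]
    exact (mem_candidates.1 hv.1).2 u hu
  · exact (mem_candidates.1 hu.1).2 v hv
  · by_contra hlt
    have hle : G.edist u v ≤ ((R - 1 : ℕ) : ℕ∞) := by
      refine Order.le_of_lt_add_one ?_
      have : (((R - 1 : ℕ) : ℕ∞) + 1) = R := by exact_mod_cast Nat.sub_add_cancel hR
      rw [this]
      exact not_le.1 hlt
    have h1 := hu.2 v hv.1 huv.symm hle
    have h2 := hv.2 u hu.1 huv (by rwa [SimpleGraph.edist_comm])
    rcases h1 with h1 | ⟨h1, h1'⟩ <;> rcases h2 with h2 | ⟨h2, h2'⟩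
    · exact lt_asymm h1 h2
    · exact h1.ne h2.symm
    · exact h2.ne h1.symm
    · exact lt_asymm h1' h2'

theorem greedyStep_iterate_subset {S : Set V} (hS : S ⊆ U) (k : ℕ) :
    (greedyStep G ℓ U R)^[k] S ⊆ U := by
  induction k with
  | zero => exact hS
  | succ k ih =>
    rw [Function.iterate_succ_apply']
    exact greedyStep_subset ih

theorem greedyStep_iterate_packing {S : Set V} (hR : 1 ≤ R)
    (hS : ∀ u ∈ S, ∀ v ∈ S, u ≠ v → (R : ℕ∞) ≤ G.edist u v) (k : ℕ) :
    ∀ u ∈ (greedyStep G ℓ U R)^[k] S, ∀ v ∈ (greedyStep G ℓ U R)^[k] S,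
      u ≠ v → (R : ℕ∞) ≤ G.edist u v := by
  induction k with
  | zero => exact hS
  | succ k ih =>
    rw [Function.iterate_succ_apply']
    exact greedyStep_packing hR ih

/-- In every gap of `S` that holds a candidate, some candidate joins. -/
theorem exists_mem_greedyStep_of_mem_candidates {pos : V → ℤ}
    (hpos : ∀ u v, G.edist u v = ((pos u - pos v).natAbs : ℕ∞)) (hℓ : Function.Injective ℓ)
    (hU : U.Finite) (hR : 1 ≤ R) {S : Set V} {v : V} (hv : v ∈ candidates G U R S) :
    ∃ c ∈ candidates G U R S, c ∈ greedyStep G ℓ U R S ∧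
      ∀ s ∈ S, (pos s < pos v ↔ pos s < pos c) := by
  -- The lexicographically largest candidate of the gap joins; finiteness of `U` provides it.
  obtain ⟨c, ⟨hc, hgap⟩, hmax⟩ := Set.exists_max_image
    {c | c ∈ candidates G U R S ∧ ∀ s ∈ S, (pos s < pos v ↔ pos s < pos c)}
    (fun u => toLex (distTo G S u, ℓ u)) (hU.subset fun c hc => hc.1.1)
    ⟨v, hv, fun _ _ => Iff.rfl⟩
  refine ⟨c, hc, Or.inr ⟨hc, fun u hu huc hd => ?_⟩, hgap⟩
  -- Candidates of other gaps do not compete: the node `s` in between is at distance at least `R`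
  -- from both.
  have hu' : ∀ s ∈ S, (pos s < pos v ↔ pos s < pos u) := by
    intro s hs
    rw [hgap s hs]
    have h1 := (mem_candidates.1 hc).2 s hs
    have h2 := (mem_candidates.1 hu).2 s hs
    rw [hpos] at h1 h2 hd
    have h1 : R ≤ _ := Nat.cast_le.1 h1
    have h2 : R ≤ _ := Nat.cast_le.1 h2
    have hd : _ ≤ R - 1 := Nat.cast_le.1 hd
    omega
  have := hmax u ⟨hu, hu'⟩
  rw [Prod.Lex.toLex_le_toLex] at this
  refine this.imp id fun h => ⟨h.1, lt_of_le_of_ne h.2 fun he => huc (hℓ he)⟩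

theorem candidates_anti {S T : Set V} (h : S ⊆ T) : candidates G U R T ⊆ candidates G U R S :=
  fun _ hv => mem_candidates.2
    ⟨hv.1, fun u hu => (mem_candidates.1 hv).2 u (h hu)⟩

theorem candidates_greedyStep_iterate_eq_empty {pos : V → ℤ}
    (hpos : ∀ u v, G.edist u v = ((pos u - pos v).natAbs : ℕ∞)) (hℓ : Function.Injective ℓ)
    (hU : U.Finite) (hR : 1 ≤ R) {S : Set V}
    (hS : ∀ u ∈ U, ∃ v ∈ S, G.edist u v ≤ ((3 * R - 1 : ℕ) : ℕ∞)) :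
    candidates G U R ((greedyStep G ℓ U R)^[6] S) = ∅ := by
  rw [Set.eq_empty_iff_forall_notMem]
  intro v hv
  have hmono := greedyStep_iterate_mono (G := G) (ℓ := ℓ) (U := U) (R := R) S
  -- For `j < 6`, `x j` is a node joining the gap of `v` in step `j + 1`, and the candidate `v`
  -- itself can serve as `x 6`. Gaps are always those of the initial `S`.
  have hex : ∀ j : Fin 7, ∃ c ∈ candidates G U R ((greedyStep G ℓ U R)^[j] S),
      ((j : ℕ) < 6 → c ∈ (greedyStep G ℓ U R)^[j + 1] S) ∧
      ∀ s ∈ S, (pos s < pos v ↔ pos s < pos c) := by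
    intro j
    by_cases hj : (j : ℕ) < 6
    · obtain ⟨c, hc, hcS, hgap⟩ := exists_mem_greedyStep_of_mem_candidates (ℓ := ℓ) hpos hℓ hU hR
        (candidates_anti (hmono hj.le) hv)
      refine ⟨c, hc, fun _ => ?_, fun s hs => hgap s (hmono (Nat.zero_le j) hs)⟩
      rw [Function.iterate_succ_apply']
      exact hcS
    · have : (j : ℕ) = 6 := by omega
      exact ⟨v, by rwa [this], fun h => absurd h hj, fun _ _ => Iff.rfl⟩
  choose x hx hxS hgap using hex
  have hfar' : ∀ i j : Fin 7, i < j → R ≤ (pos (x i) - pos (x j)).natAbs := by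
    intro i j hij
    have hij' : (i : ℕ) + 1 ≤ j := hij
    have h := (mem_candidates.1 (hx j)).2 (x i) (hmono hij' (hxS i (by omega)))
    rw [hpos] at h
    have h : R ≤ _ := Nat.cast_le.1 h
    omega
  have hfar : ∀ i j : Fin 7, i ≠ j → R ≤ (pos (x i) - pos (x j)).natAbs := by
    intro i j hij
    rcases lt_or_gt_of_ne hij with h | h
    · exact hfar' i j h
    · have := hfar' j i h
      omega
  have hnear : ∀ j, ∃ s ∈ S, (pos (x j) - pos s).natAbs < 3 * R := by
    intro j
    obtain ⟨s, hs, hd⟩ := hS _ (hx j).1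
    rw [hpos] at hd
    have hd : _ ≤ 3 * R - 1 := Nat.cast_le.1 hd
    exact ⟨s, hs, by omega⟩
  choose s hs hsx using hnear
  have hsep : ∀ i j, R ≤ (pos (x i) - pos (s j)).natAbs := by
    intro i j
    have h := (mem_candidates.1 (hx i)).2 (s j) (hmono (Nat.zero_le i) (hs j))
    rw [hpos] at h
    exact Nat.cast_le.1 h
  have hside : ∀ i j, (pos (s j) < pos (x i) ↔ pos (s j) < pos v) :=
    fun i j => (hgap i _ (hs j)).symm
  -- With all three nearby nodes of `S` on the left, let `s` be the rightmost of them. The three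
  -- points lie in the half-open interval [s + R, s + 3R) of length 2R, which is too short for three
  -- points with spacing `R`. The right side is symmetric.
  have key : ∀ i j k : Fin 7, i ≠ j → i ≠ k → j ≠ k →
      ((pos (s i) < pos v ∧ pos (s j) < pos v ∧ pos (s k) < pos v) ∨
      (¬ pos (s i) < pos v ∧ ¬ pos (s j) < pos v ∧ ¬ pos (s k) < pos v)) → False := by
    intro i j k hij hik hjk h
    have := hfar i j hij
    have := hfar i k hik
    have := hfar j k hjk
    have := hsx i; have := hsx j; have := hsx k
    have := hsep i i; have := hsep j i; have := hsep k i
    have := hsep i j; have := hsep j j; have := hsep k j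
    have := hsep i k; have := hsep j k; have := hsep k k
    have := hside i i; have := hside j i; have := hside k i
    have := hside i j; have := hside j j; have := hside k j
    have := hside i k; have := hside j k; have := hside k k
    rcases h with ⟨h1, h2, h3⟩ | ⟨h1, h2, h3⟩ <;>
      simp only [h1, h2, h3, iff_true, iff_false] at * <;> omega
  have hcard := Finset.card_filter_add_card_filter_not (s := (Finset.univ : Finset (Fin 7)))
    (fun j => pos (s j) < pos v)
  rw [Finset.card_univ, Fintype.card_fin] at hcard
  rcases (by omega : 2 < (Finset.univ.filter fun j => pos (s j) < pos v).card ∨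
      2 < (Finset.univ.filter fun j => ¬ pos (s j) < pos v).card) with h | h
  · obtain ⟨i, j, k, hi, hj, hk, hij, hik, hjk⟩ := Finset.two_lt_card_iff.1 h
    exact key i j k hij hik hjk (Or.inl ⟨(Finset.mem_filter.1 hi).2, (Finset.mem_filter.1 hj).2,
      (Finset.mem_filter.1 hk).2⟩)
  · obtain ⟨i, j, k, hi, hj, hk, hij, hik, hjk⟩ := Finset.two_lt_card_iff.1 h
    exact key i j k hij hik hjk (Or.inr ⟨(Finset.mem_filter.1 hi).2, (Finset.mem_filter.1 hj).2,
      (Finset.mem_filter.1 hk).2⟩)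

/-- Every execution of PathRulingSet returns a limited ruling set. -/
theorem IsOutput.isLimitedRulingSet (hG : IsPathOrLine G) (hℓ : Function.Injective ℓ)
    (hU : U.Finite) (hR : 1 ≤ R) {T : Set V} (hT : IsOutput G ℓ U R T) :
    IsLimitedRulingSet G U R (R - 1) T := by
  obtain ⟨pos, hpos⟩ := hG.exists_isometry_int
  obtain ⟨S, hS, rfl⟩ := isOutput_iff.1 hT
  refine ⟨greedyStep_iterate_subset hS.subset 6,
    greedyStep_iterate_packing hR (fun u hu v hv => hS.packing hu hv) 6, fun u hu => ?_⟩
  have hempty := candidates_greedyStep_iterate_eq_empty (ℓ := ℓ) hpos hℓ hU hR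
    (fun u hu => hS.covering hR hu)
  have := Set.eq_empty_iff_forall_notMem.1 hempty u
  rw [mem_candidates] at this
  push Not at this
  obtain ⟨v, hv, hlt⟩ := this hu
  refine ⟨v, hv, Order.le_of_lt_add_one ?_⟩
  have : (((R - 1 : ℕ) : ℕ∞) + 1) = R := by exact_mod_cast Nat.sub_add_cancel hR
  rwa [this]

end PathRulingSet

/-! ### Colour reduction and maximal independent sets from colourings -/

/-- The lowest bit in which `a` and `b` differ. -/
noncomputable def firstDiff (a b : ℕ) : ℕ := sInf {i | a.testBit i ≠ b.testBit i}

theorem testBit_firstDiff_ne {a b : ℕ} (h : a ≠ b) :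
    a.testBit (firstDiff a b) ≠ b.testBit (firstDiff a b) :=
  Nat.sInf_mem (s := {i | a.testBit i ≠ b.testBit i}) (Nat.exists_testBit_ne_of_ne h)

theorem firstDiff_le_log {a b X : ℕ} (h : a ≠ b) (ha : a ≤ X) (hb : b ≤ X) :
    firstDiff a b ≤ Nat.log 2 X := by
  have hX : 2 ^ firstDiff a b ≤ X := by
    by_cases h1 : a.testBit (firstDiff a b) = true
    · exact (Nat.ge_two_pow_of_testBit h1).trans ha
    · refine (Nat.ge_two_pow_of_testBit (x := b) ?_).trans hb
      have := testBit_firstDiff_ne h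
      by_contra h2
      exact this ((Bool.eq_false_iff.2 h1).trans (Bool.eq_false_iff.2 h2).symm)
  exact Nat.le_log_of_pow_le (by norm_num) hX

/-- For each colour `b` of a neighbour, the lowest bit in which the own colour `a` differs
from `b`, together with the value of that bit in `a`. -/
noncomputable def diffBits (a : ℕ) (N : Set ℕ) : Set ℕ :=
  (fun b => 2 * firstDiff a b + (a.testBit (firstDiff a b)).toNat) '' N

/-- The new colour of a node of colour `a` whose neighbours have the colours in `N`. -/
noncomputable def reduceColour (a : ℕ) (N : Set ℕ) : ℕ :=
  Nat.pair (sInf (diffBits a N)) (sSup (diffBits a N))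

theorem eq_pair_sInf_sSup {P : Set ℕ} (hP : P.Nonempty) {x y : ℕ} (h : P ⊆ {x, y}) :
    P = {sInf P, sSup P} := by
  rcases Set.subset_pair_iff_eq.1 h with rfl | rfl | rfl | rfl
  · exact absurd hP Set.not_nonempty_empty
  · simp
  · simp
  · rw [csSup_pair, csInf_pair]
    rcases le_total x y with hxy | hxy
    · rw [inf_eq_left.2 hxy, sup_eq_right.2 hxy]
    · rw [inf_eq_right.2 hxy, sup_eq_left.2 hxy, Set.pair_comm]

/-- A nonempty set of at most two numbers is recovered from its minimum and maximum, so equal new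
colours force equal sets of recorded bits. The entry of `a` for its neighbour `b` would then also be
an entry of `b`, so `a` and `b` would agree in the lowest bit where they differ. No orientation of
the path is needed. -/
theorem reduceColour_ne {a b : ℕ} {M N : Set ℕ} (hab : a ≠ b) (hb : b ∈ N) (ha : a ∈ M)
    (hN : ∃ x y, N ⊆ {x, y}) (hM : ∃ x y, M ⊆ {x, y}) :
    reduceColour a N ≠ reduceColour b M := by
  have pair : ∀ (c : ℕ) (L : Set ℕ), L.Nonempty → (∃ x y, L ⊆ {x, y}) →
      diffBits c L = {sInf (diffBits c L), sSup (diffBits c L)} := by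
    rintro c L hL ⟨x, y, h⟩
    exact eq_pair_sInf_sSup (hL.image _) ((Set.image_mono h).trans (Set.image_pair _ x y).subset)
  intro h
  obtain ⟨h1, h2⟩ := Nat.pair_eq_pair.1 h
  have heq : diffBits a N = diffBits b M := by
    rw [pair a N ⟨b, hb⟩ hN, pair b M ⟨a, ha⟩ hM, h1, h2]
  have hmem : 2 * firstDiff a b + (a.testBit (firstDiff a b)).toNat ∈ diffBits b M :=
    heq ▸ ⟨b, hb, rfl⟩
  obtain ⟨d, -, hd⟩ := hmem
  have hl1 := Bool.toNat_lt (b.testBit (firstDiff b d))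
  have hl2 := Bool.toNat_lt (a.testBit (firstDiff a b))
  simp only at hd
  have hi : firstDiff b d = firstDiff a b := by omega
  rw [hi] at hd
  have hbit : b.testBit (firstDiff a b) = a.testBit (firstDiff a b) := by
    have hnat := Nat.add_left_cancel hd
    revert hnat
    cases b.testBit (firstDiff a b) <;> cases a.testBit (firstDiff a b) <;> simp
  exact testBit_firstDiff_ne hab hbit.symm

theorem reduceColour_lt {a X : ℕ} {N : Set ℕ} (ha : a ≤ X) (hN : ∀ b ∈ N, b ≠ a ∧ b ≤ X) :
    reduceColour a N < (2 * Nat.log 2 X + 2) ^ 2 := by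
  have hP : ∀ p ∈ diffBits a N, p ≤ 2 * Nat.log 2 X + 1 := by
    rintro _ ⟨b, hb, rfl⟩
    have h1 := firstDiff_le_log (hN b hb).1.symm ha (hN b hb).2
    have h2 := Bool.toNat_lt (a.testBit (firstDiff a b))
    simp only
    omega
  have hsup : sSup (diffBits a N) ≤ 2 * Nat.log 2 X + 1 := csSup_le' hP
  have hinf : sInf (diffBits a N) ≤ 2 * Nat.log 2 X + 1 := by
    rcases (diffBits a N).eq_empty_or_nonempty with h | h
    · simp [h]
    · exact hP _ (Nat.sInf_mem h)
  refine (Nat.pair_lt_max_add_one_sq _ _).trans_le (Nat.pow_le_pow_left ?_ 2)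
  have := max_le hinf hsup
  omega

/-! ### Iterated colour reduction on power graphs of degree at most two. -/

section PowerGraphColouring

variable {V : Type*} {G : SimpleGraph V} {ℓ : V → ℕ+} {r : ℕ} {S : Set V}

/-- The neighbours of `v` in the subgraph of `G ^ r` induced by `S`. -/
def powerNeighbors (G : SimpleGraph V) (r : ℕ) (S : Set V) (v : V) : Set V :=
  {u | u ∈ S ∧ u ≠ v ∧ G.edist v u ≤ r}

theorem mem_powerNeighbors_comm {u v : V} (hu : u ∈ S) (h : v ∈ powerNeighbors G r S u) :
    u ∈ powerNeighbors G r S v :=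
  ⟨hu, h.2.1.symm, by rw [SimpleGraph.edist_comm]; exact h.2.2⟩

/-- Of two neighbours on the same side of `v`, the farther one would be at distance at least `2 * p
> r`. -/
theorem powerNeighbors_subset_pair {pos : V → ℤ}
    (hpos : ∀ u v, G.edist u v = ((pos u - pos v).natAbs : ℕ∞)) {p : ℕ} (hr : r < 2 * p)
    (hS : ∀ u ∈ S, ∀ v ∈ S, u ≠ v → (p : ℕ∞) ≤ G.edist u v) {v : V} (hv : v ∈ S) :
    ∃ a b, powerNeighbors G r S v ⊆ {a, b} := by
  have key : ∀ u ∈ powerNeighbors G r S v, ∀ w ∈ powerNeighbors G r S v,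
      (pos v < pos u ↔ pos v < pos w) → u = w := by
    intro u hu w hw h
    by_contra huw
    have h1 := hS u hu.1 w hw.1 huw
    have h2 := hS u hu.1 v hv hu.2.1
    have h3 := hS w hw.1 v hv hw.2.1
    have h4 := hu.2.2
    have h5 := hw.2.2
    rw [hpos] at h1 h2 h3 h4 h5
    have h1 : p ≤ _ := Nat.cast_le.1 h1
    have h2 : p ≤ _ := Nat.cast_le.1 h2
    have h3 : p ≤ _ := Nat.cast_le.1 h3
    have h4 : _ ≤ r := Nat.cast_le.1 h4
    have h5 : _ ≤ r := Nat.cast_le.1 h5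
    omega
  have side : ∀ q : Prop, ∃ a, ∀ u ∈ powerNeighbors G r S v, (pos v < pos u ↔ q) → u = a := by
    intro q
    by_cases h : ∃ a ∈ powerNeighbors G r S v, (pos v < pos a ↔ q)
    · obtain ⟨a, ha, hq⟩ := h
      exact ⟨a, fun u hu hq' => key u hu a ha (hq'.trans hq.symm)⟩
    · exact ⟨v, fun u hu hq => absurd ⟨u, hu, hq⟩ h⟩
  obtain ⟨a, ha⟩ := side True
  obtain ⟨b, hb⟩ := side False
  refine ⟨a, b, fun u hu => ?_⟩
  by_cases h : pos v < pos u
  · exact Or.inl (ha u hu (by simpa using h))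
  · exact Or.inr (hb u hu (by simpa using h))

/-- The colouring after `j` rounds of colour reduction, starting from the identifiers. -/
noncomputable def reducedColouring (G : SimpleGraph V) (ℓ : V → ℕ+) (r : ℕ) (S : Set V) :
    ℕ → V → ℕ
  | 0, v => ℓ v
  | j + 1, v => reduceColour (reducedColouring G ℓ r S j v)
      (reducedColouring G ℓ r S j '' powerNeighbors G r S v)

theorem reducedColouring_ne (hℓ : Function.Injective ℓ)
    (hdeg : ∀ v ∈ S, ∃ a b, powerNeighbors G r S v ⊆ {a, b}) (j : ℕ) {u v : V} (hu : u ∈ S)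
    (huv : v ∈ powerNeighbors G r S u) :
    reducedColouring G ℓ r S j u ≠ reducedColouring G ℓ r S j v := by
  induction j generalizing u v with
  | zero => exact fun h => huv.2.1 (hℓ (PNat.coe_injective h)).symm
  | succ j ih =>
    have himage : ∀ w ∈ S, ∃ x y,
        reducedColouring G ℓ r S j '' powerNeighbors G r S w ⊆ {x, y} := by
      intro w hw
      obtain ⟨a, b, hab⟩ := hdeg w hw
      exact ⟨_, _, (Set.image_mono hab).trans (Set.image_pair _ a b).subset⟩
    exact reduceColour_ne (ih hu huv) ⟨v, huv, rfl⟩ ⟨u, mem_powerNeighbors_comm hu huv, rfl⟩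
      (himage u hu) (himage v huv.1)

/-- The bound 1024 x² reproduces itself with log₂ x in place of x: the new colour is at most (2(10 +
2 log₂ x) + 2)² ≤ (32 max(log₂ x, 1))², and 32² = 1024. The maximum with 1 covers the last step,
where log₂ x may drop below 1. -/
theorem reducedColouring_succ_le (hℓ : Function.Injective ℓ)
    (hdeg : ∀ v ∈ S, ∃ a b, powerNeighbors G r S v ⊆ {a, b}) {j : ℕ} {x : ℝ} (hx : 1 < x)
    (h : ∀ v ∈ S, (reducedColouring G ℓ r S j v : ℝ) ≤ 1024 * max x 1 ^ 2) :
    ∀ v ∈ S, (reducedColouring G ℓ r S (j + 1) v : ℝ) ≤ 1024 * max (Real.logb 2 x) 1 ^ 2 := by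
  intro v hv
  rw [max_eq_left hx.le] at h
  have hX : ∀ w ∈ S, reducedColouring G ℓ r S j w ≤ ⌊1024 * x ^ 2⌋₊ :=
    fun w hw => Nat.le_floor (h w hw)
  have hlt : reducedColouring G ℓ r S (j + 1) v < (2 * Nat.log 2 ⌊1024 * x ^ 2⌋₊ + 2) ^ 2 := by
    refine reduceColour_lt (hX v hv) ?_
    rintro _ ⟨u, hu, rfl⟩
    exact ⟨(reducedColouring_ne hℓ hdeg j hv hu).symm, hX u hu.1⟩
  have hz : 0 < Real.logb 2 x := Real.logb_pos (by norm_num) hx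
  have hx2 : 1 ≤ 1024 * x ^ 2 := by nlinarith
  have hlog : (Nat.log 2 ⌊1024 * x ^ 2⌋₊ : ℝ) ≤ 10 + 2 * Real.logb 2 x := by
    calc (Nat.log 2 ⌊1024 * x ^ 2⌋₊ : ℝ) ≤ Real.logb 2 ⌊1024 * x ^ 2⌋₊ := by
          exact_mod_cast Real.natLog_le_logb _ 2
      _ ≤ Real.logb 2 (1024 * x ^ 2) :=
          Real.logb_le_logb_of_le (by norm_num)
            (by exact_mod_cast Nat.floor_pos.2 hx2) (Nat.floor_le (by positivity))
      _ = 10 + 2 * Real.logb 2 x := by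
          rw [Real.logb_mul (by norm_num) (by positivity), Real.logb_pow]
          have : Real.logb 2 1024 = 10 := by
            rw [show (1024 : ℝ) = 2 ^ (10 : ℕ) by norm_num, Real.logb_pow,
              Real.logb_self_eq_one (by norm_num)]
            norm_num
          rw [this]
          norm_num
  have hreal : (reducedColouring G ℓ r S (j + 1) v : ℝ)
      ≤ (2 * (Nat.log 2 ⌊1024 * x ^ 2⌋₊ : ℝ) + 2) ^ 2 := by exact_mod_cast hlt.le
  have h1 := le_max_left (Real.logb 2 x) 1
  have h2 := le_max_right (Real.logb 2 x) 1
  calc (reducedColouring G ℓ r S (j + 1) v : ℝ)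
      ≤ (2 * (Nat.log 2 ⌊1024 * x ^ 2⌋₊ : ℝ) + 2) ^ 2 := hreal
    _ ≤ (32 * max (Real.logb 2 x) 1) ^ 2 := by
        refine pow_le_pow_left₀ (by positivity) ?_ 2
        linarith
    _ = 1024 * max (Real.logb 2 x) 1 ^ 2 := by ring

theorem reducedColouring_le_of_logStar (hℓ : Function.Injective ℓ)
    (hdeg : ∀ v ∈ S, ∃ a b, powerNeighbors G r S v ⊆ {a, b}) (m : ℕ) {j : ℕ} {x : ℝ}
    (hm : logStar x = m + 1)
    (h : ∀ v ∈ S, (reducedColouring G ℓ r S j v : ℝ) ≤ 1024 * max x 1 ^ 2) :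
    ∀ v ∈ S, reducedColouring G ℓ r S (j + m) v ≤ 1024 := by
  induction m generalizing j x with
  | zero =>
    have hx : x ≤ 1 := by
      by_contra hx
      rw [logStar_of_lt (not_le.1 hx), logStar] at hm
      omega
    intro v hv
    have := h v hv
    rw [max_eq_right hx, one_pow, mul_one] at this
    exact_mod_cast this
  | succ m ih =>
    have hx : 1 < x := by
      by_contra hx
      rw [logStar_of_le (not_lt.1 hx)] at hm
      omega
    rw [logStar_of_lt hx] at hm
    have := ih (j := j + 1) (by omega) (reducedColouring_succ_le hℓ hdeg hx h)
    rwa [show j + 1 + m = j + (m + 1) by omega] at this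

theorem reducedColouring_le (hℓ : Function.Injective ℓ)
    (hdeg : ∀ v ∈ S, ∃ a b, powerNeighbors G r S v ⊆ {a, b}) {n : ℕ}
    (hn : ∀ v ∈ S, (ℓ v : ℕ) ≤ n) :
    ∀ v ∈ S, reducedColouring G ℓ r S (logStar n - 1) v ≤ 1024 := by
  have h1 : logStar (n : ℝ) = logStar (n : ℝ) - 1 + 1 := by
    simp [logStar, add_comm]
  have h := reducedColouring_le_of_logStar hℓ hdeg (logStar (n : ℝ) - 1) (j := 0) (x := n) h1 ?_
  · rwa [Nat.zero_add] at h
  · intro v hv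
    have h1 : ((ℓ v : ℕ) : ℝ) ≤ max (n : ℝ) 1 :=
      (Nat.cast_le.2 (hn v hv)).trans (le_max_left _ _)
    have h2 := le_max_right (n : ℝ) 1
    change ((ℓ v : ℕ) : ℝ) ≤ _
    nlinarith

/-! ### Maximal independent sets from colour classes. -/

/-- The independent set built greedily from the colour classes `0, …, m - 1`. -/
def greedyMIS (G : SimpleGraph V) (r : ℕ) (S : Set V) (c : V → ℕ) : ℕ → Set V
  | 0 => ∅
  | m + 1 => greedyMIS G r S c m ∪
      {v | v ∈ S ∧ c v = m ∧ ∀ u ∈ powerNeighbors G r S v, u ∉ greedyMIS G r S c m}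

theorem greedyMIS_subset (c : V → ℕ) (m : ℕ) : greedyMIS G r S c m ⊆ S := by
  induction m with
  | zero => exact Set.empty_subset _
  | succ m ih => exact Set.union_subset ih fun v hv => hv.1

theorem greedyMIS_mono (c : V → ℕ) : Monotone (greedyMIS G r S c) :=
  monotone_nat_of_le_succ fun _ => Set.subset_union_left

theorem notMem_powerNeighbors_of_mem_greedyMIS {c : V → ℕ}
    (hc : ∀ u ∈ S, ∀ v ∈ powerNeighbors G r S u, c u ≠ c v) (m : ℕ) {u v : V}
    (hu : u ∈ greedyMIS G r S c m) (hv : v ∈ greedyMIS G r S c m) :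
    v ∉ powerNeighbors G r S u := by
  induction m with
  | zero => exact absurd hu (Set.notMem_empty u)
  | succ m ih =>
    intro h
    rcases hu with hu | hu <;> rcases hv with hv | hv
    · exact ih hu hv h
    · exact hv.2.2 u (mem_powerNeighbors_comm (greedyMIS_subset c m hu) h) hu
    · exact hu.2.2 v h hv
    · exact hc u hu.1 v h (hu.2.1.trans hv.2.1.symm)

theorem isLimitedRulingSet_greedyMIS {c : V → ℕ}
    (hc : ∀ u ∈ S, ∀ v ∈ powerNeighbors G r S u, c u ≠ c v) {m : ℕ} (hm : ∀ v ∈ S, c v < m) :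
    IsLimitedRulingSet G S (r + 1) r (greedyMIS G r S c m) := by
  refine ⟨greedyMIS_subset c m, fun u hu v hv huv => ?_, fun u hu => ?_⟩
  · have := notMem_powerNeighbors_of_mem_greedyMIS hc m hu hv
    rw [Nat.cast_add, Nat.cast_one, ENat.add_one_le_iff (ENat.natCast_ne_top r)]
    by_contra hle
    exact this ⟨greedyMIS_subset c m hv, huv.symm, not_lt.1 hle⟩
  · have hsub : greedyMIS G r S c (c u + 1) ⊆ greedyMIS G r S c m := greedyMIS_mono c (hm u hu)
    by_cases h : ∀ w ∈ powerNeighbors G r S u, w ∉ greedyMIS G r S c (c u)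
    · exact ⟨u, hsub (Or.inr ⟨hu, rfl, h⟩), by simp⟩
    · push Not at h
      obtain ⟨w, hw, hwm⟩ := h
      exact ⟨w, hsub (Or.inl hwm), hw.2.2⟩

end PowerGraphColouring

/-! ### Full-information algorithms and locality -/

/-- What a node can know after `t` rounds. -/
def View (In : Type) : ℕ → Type
  | 0 => In
  | t + 1 => View In t × Multiset (View In t)

/-- What the node `v` learns in `t` rounds in which all nodes send all that they know. -/
def view {In : Type} {V : Type*} (G : SimpleGraph V) [G.LocallyFinite] (input : V → In) :
    (t : ℕ) → V → View In t
  | 0, v => input v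
  | t + 1, v => (view G input t v, (G.neighborFinset v).val.map (view G input t))

/-- The algorithm that collects information for `T` rounds and then applies `g`. -/
def fullInformation {In Out : Type} (T : ℕ) (g : View In T → Out) : LocalAlgorithm In Out where
  State := Σ t, View In t
  Msg := Σ t, View In t
  init x := ⟨0, x⟩
  send s := s
  receive s M := ⟨s.1 + 1, (s.2, M.filterMap fun m =>
    if h : m.1 = s.1 then some (h ▸ m.2) else none)⟩
  output s := if h : s.1 = T then some (g (h ▸ s.2)) else none

/-- All nodes are in the same round and none terminates before round `T`, so neither the round check
in `receive` nor the silence of terminated nodes discards a message. -/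
theorem run_fullInformation {In Out : Type} {T : ℕ} (g : View In T → Out) {V : Type*}
    (G : SimpleGraph V) [G.LocallyFinite] (input : V → In) {t : ℕ} (ht : t ≤ T) (v : V) :
    (fullInformation T g).run G input t v = ⟨t, view G input t v⟩ := by
  induction t generalizing v with
  | zero => rfl
  | succ t ih =>
    have ih := ih (by omega)
    have hout : ∀ u, ((fullInformation T g).output ⟨t, view G input t u⟩).isSome = false := by
      intro u
      simp only [fullInformation]
      rw [dif_neg (by omega)]
      rfl
    rw [LocalAlgorithm.run]
    simp only [ih, hout, Bool.false_eq_true, if_false]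
    simp only [fullInformation, view, Multiset.filterMap_filterMap, Option.bind_some, dite_true]
    rw [← Multiset.filterMap_eq_map]
    rfl

theorem output_run_fullInformation {In Out : Type} {T : ℕ} (g : View In T → Out) {V : Type*}
    (G : SimpleGraph V) [G.LocallyFinite] (input : V → In) (v : V) :
    (fullInformation T g).output ((fullInformation T g).run G input T v) =
      some (g (view G input T v)) := by
  rw [run_fullInformation g G input le_rfl]
  simp [fullInformation]

-- Comparing the views of nodes in different inputs.

universe u

/-- The inputs on which the algorithm has to be correct: paths or lines with distinct identifiers
and a finite set `U` of nodes whose identifiers are at most `n`. -/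
structure PathInput (n : ℕ) where
  V : Type u
  G : SimpleGraph V
  [locallyFinite : G.LocallyFinite]
  ℓ : V → ℕ+
  U : Set V
  isPathOrLine : IsPathOrLine G
  injective : Function.Injective ℓ
  finite : U.Finite
  le : ∀ v ∈ U, (ℓ v : ℕ) ≤ n

namespace PathInput

attribute [instance] PathInput.locallyFinite

variable {n : ℕ}

/-- The view of a node of a `PathInput`. -/
noncomputable def nodeView (I : PathInput.{u} n) (t : ℕ) (v : I.V) : View (ℕ+ × Bool) t :=
  view I.G (localInput I.ℓ I.U) t v

theorem nodeView_eq_of_le {I J : PathInput.{u} n} {v : I.V} {w : J.V} {s t : ℕ} (hst : s ≤ t)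
    (h : I.nodeView t v = J.nodeView t w) : I.nodeView s v = J.nodeView s w := by
  induction t, hst using Nat.le_induction with
  | base => exact h
  | succ t _ ih => exact ih (congrArg Prod.fst h)

theorem ℓ_eq_of_nodeView_eq {I J : PathInput.{u} n} {v : I.V} {w : J.V} {t : ℕ}
    (h : I.nodeView t v = J.nodeView t w) : I.ℓ v = J.ℓ w :=
  congrArg Prod.fst (nodeView_eq_of_le (Nat.zero_le t) h)

theorem mem_U_iff_of_nodeView_eq {I J : PathInput.{u} n} {v : I.V} {w : J.V} {t : ℕ}
    (h : I.nodeView t v = J.nodeView t w) : v ∈ I.U ↔ w ∈ J.U :=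
  decide_eq_decide.1 (congrArg Prod.snd (nodeView_eq_of_le (Nat.zero_le t) h))

theorem exists_adj_of_nodeView_eq {I J : PathInput.{u} n} {v x : I.V} {w : J.V} {t : ℕ}
    (h : I.nodeView (t + 1) v = J.nodeView (t + 1) w) (hx : I.G.Adj v x) :
    ∃ y, J.G.Adj w y ∧ I.nodeView t x = J.nodeView t y := by
  have hM : (I.G.neighborFinset v).val.map (I.nodeView t) =
      (J.G.neighborFinset w).val.map (J.nodeView t) := congrArg Prod.snd h
  have hmem : I.nodeView t x ∈ (I.G.neighborFinset v).val.map (I.nodeView t) :=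
    Multiset.mem_map_of_mem _ ((I.G.mem_neighborFinset v x).2 hx)
  rw [hM, Multiset.mem_map] at hmem
  obtain ⟨y, hy, he⟩ := hmem
  exact ⟨y, (J.G.mem_neighborFinset w y).1 hy, he.symm⟩

/-- Equal views of radius `t + k` have matching balls of radius `k` of views of radius `t`. -/
theorem exists_edist_le_of_nodeView_eq {I J : PathInput.{u} n} {v x : I.V} {w : J.V} {t k : ℕ}
    (h : I.nodeView (t + k) v = J.nodeView (t + k) w) (hx : I.G.edist v x ≤ k) :
    ∃ y, J.G.edist w y ≤ k ∧ I.nodeView t x = J.nodeView t y := by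
  induction k generalizing v w with
  | zero =>
    obtain rfl : v = x := I.G.edist_eq_zero_iff.1 (nonpos_iff_eq_zero.1 hx)
    exact ⟨w, by simp, h⟩
  | succ k ih =>
    obtain ⟨p, hp⟩ := I.isPathOrLine.connected.exists_walk_length_eq_edist v x
    rw [← hp] at hx
    have hlen : p.length ≤ k + 1 := Nat.cast_le.1 hx
    cases p with
    | nil => exact ⟨w, by simp, nodeView_eq_of_le (by omega) h⟩
    | @cons _ v' _ hadj q =>
      rw [SimpleGraph.Walk.length_cons] at hlen
      obtain ⟨w', hw', he⟩ := exists_adj_of_nodeView_eq (t := t + k) h hadj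
      obtain ⟨y, hy, hey⟩ := ih he
        ((SimpleGraph.edist_le q).trans (Nat.cast_le.2 (by omega)))
      refine ⟨y, ?_, hey⟩
      refine SimpleGraph.edist_triangle.trans
        ((add_le_add (SimpleGraph.edist_eq_one_iff_adj.2 hw').le hy).trans ?_)
      rw [Nat.cast_add, Nat.cast_one, add_comm]

/-- A node can compute `f` from its view of radius `t`. -/
def IsLocal {Y : Type*} (t : ℕ) (f : ∀ I : PathInput.{u} n, I.V → Y) : Prop :=
  ∀ ⦃I J : PathInput.{u} n⦄ ⦃v : I.V⦄ ⦃w : J.V⦄, I.nodeView t v = J.nodeView t w → f I v = f J w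

namespace IsLocal

variable {Y Z W : Type*}

theorem mono {f : ∀ I : PathInput.{u} n, I.V → Y} {s t : ℕ} (hf : IsLocal s f) (hst : s ≤ t) :
    IsLocal t f :=
  fun _ _ _ _ h => hf (nodeView_eq_of_le hst h)

theorem comp₂ (F : Y → Z → W) {f : ∀ I : PathInput.{u} n, I.V → Y}
    {g : ∀ I : PathInput.{u} n, I.V → Z} {t : ℕ} (hf : IsLocal t f) (hg : IsLocal t g) :
    IsLocal t fun I v => F (f I v) (g I v) :=
  fun _ _ _ _ h => congrArg₂ F (hf h) (hg h)

theorem exists_mem_powerNeighbors {S : ∀ I : PathInput.{u} n, Set I.V} {t r : ℕ}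
    (hS : IsLocal t fun I v => v ∈ S I) {I J : PathInput.{u} n} {v x : I.V} {w : J.V}
    (h : I.nodeView (t + r) v = J.nodeView (t + r) w) (hx : x ∈ powerNeighbors I.G r (S I) v) :
    ∃ y ∈ powerNeighbors J.G r (S J) w, I.nodeView t x = J.nodeView t y := by
  obtain ⟨y, hy, he⟩ := exists_edist_le_of_nodeView_eq h hx.2.2
  refine ⟨y, ⟨(hS he).mp hx.1, ?_, hy⟩, he⟩
  -- Views do not distinguish nodes by themselves; distinct identifiers ensure that the match of a
  -- node other than `v` is not `w`.
  rintro rfl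
  exact hx.2.1 (I.injective ((ℓ_eq_of_nodeView_eq he).trans (ℓ_eq_of_nodeView_eq h).symm))

/-- Matching of views need not be a bijection between balls, so only the set of values on the
neighbours is claimed to be local; this is all that the colour reduction and the greedy construction
use. -/
theorem image_powerNeighbors {S : ∀ I : PathInput.{u} n, Set I.V} {t r : ℕ}
    (hS : IsLocal t fun I v => v ∈ S I) {f : ∀ I : PathInput.{u} n, I.V → Y} (hf : IsLocal t f) :
    IsLocal (t + r) fun I v => f I '' powerNeighbors I.G r (S I) v := by
  have key : ∀ ⦃I J : PathInput.{u} n⦄ ⦃v : I.V⦄ ⦃w : J.V⦄,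
      I.nodeView (t + r) v = J.nodeView (t + r) w →
      f I '' powerNeighbors I.G r (S I) v ⊆ f J '' powerNeighbors J.G r (S J) w := by
    rintro I J v w h _ ⟨x, hx, rfl⟩
    obtain ⟨y, hy, he⟩ := exists_mem_powerNeighbors hS h hx
    exact ⟨y, hy, (hf he).symm⟩
  exact fun I J v w h => (key h).antisymm (key h.symm)

theorem reducedColouring {S : ∀ I : PathInput.{u} n, Set I.V} {t : ℕ} (r : ℕ)
    (hS : IsLocal t fun I v => v ∈ S I) (j : ℕ) :
    IsLocal (t + j * r) fun I v => _root_.reducedColouring I.G I.ℓ r (S I) j v := by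
  induction j with
  | zero => exact fun I J v w h => congrArg PNat.val (ℓ_eq_of_nodeView_eq h)
  | succ j ih =>
    rw [Nat.succ_mul, ← add_assoc]
    exact (ih.mono (Nat.le_add_right _ r)).comp₂ reduceColour
      ((hS.mono (Nat.le_add_right _ _)).image_powerNeighbors ih)

theorem greedyMIS {S : ∀ I : PathInput.{u} n, Set I.V} {c : ∀ I : PathInput.{u} n, I.V → ℕ}
    {t : ℕ} (r : ℕ) (hS : IsLocal t fun I v => v ∈ S I) (hc : IsLocal t c) (m : ℕ) :
    IsLocal (t + m * r) fun I v => v ∈ _root_.greedyMIS I.G r (S I) (c I) m := by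
  induction m with
  | zero => exact fun I J v w h => rfl
  | succ m ih =>
    rw [Nat.succ_mul, ← add_assoc]
    have hM := (hS.mono (Nat.le_add_right _ _)).image_powerNeighbors (r := r) ih
    intro I J v w h
    have h1 := ih.mono (Nat.le_add_right _ r) h
    have h2 := hS.mono (show t ≤ t + m * r + r by omega) h
    have h3 := hc.mono (show t ≤ t + m * r + r by omega) h
    have h4 := hM h
    have h5 : ∀ K : PathInput.{u} n, ∀ z : K.V,
        (∀ u ∈ powerNeighbors K.G r (S K) z, u ∉ _root_.greedyMIS K.G r (S K) (c K) m) ↔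
          ∀ q ∈ (fun u => u ∈ _root_.greedyMIS K.G r (S K) (c K) m) ''
            powerNeighbors K.G r (S K) z, ¬ q := by
      intro K z
      rw [Set.forall_mem_image]
    simp only [_root_.greedyMIS, Set.mem_union, Set.mem_ofPred_eq, h5] at h1 h2 h4 ⊢
    rw [h1, h2, h3, h4]

end IsLocal

end PathInput

/-! ### PathRulingSet in the LOCAL model -/

namespace PathInput

open PathRulingSet

variable {n : ℕ} {R : ℕ}

theorem distTo_le_of_nodeView_eq {S : ∀ I : PathInput.{u} n, Set I.V} {t : ℕ}
    (hS : IsLocal t fun I v => v ∈ S I)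
    (hcov : ∀ I : PathInput.{u} n, ∀ x ∈ I.U, ∃ y ∈ S I, I.G.edist x y ≤ ((3 * R - 1 : ℕ) : ℕ∞))
    {I J : PathInput.{u} n} {v : I.V} {w : J.V} (hw : w ∈ J.U)
    (h : I.nodeView (t + 3 * R) v = J.nodeView (t + 3 * R) w) :
    distTo J.G (S J) w ≤ distTo I.G (S I) v := by
  refine le_iInf₂ fun s hs => ?_
  by_cases hd : I.G.edist v s ≤ ((3 * R : ℕ) : ℕ∞)
  · obtain ⟨k, hk⟩ := ENat.ne_top_iff_exists.1 (ne_top_of_le_ne_top (ENat.natCast_ne_top _) hd)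
    rw [← hk] at hd ⊢
    have hkR : k ≤ 3 * R := Nat.cast_le.1 hd
    obtain ⟨s', hd', he⟩ := exists_edist_le_of_nodeView_eq
      (nodeView_eq_of_le (show t + k ≤ t + 3 * R by omega) h) hk.ge
    exact (iInf₂_le s' ((hS he).mp hs)).trans hd'
  -- A node `s` beyond distance 3R is out of view, but covering already bounds the distance of `w`
  -- to the set by 3R - 1.
  · obtain ⟨y, hy, hd'⟩ := hcov J w hw
    refine (iInf₂_le y hy).trans (hd'.trans (le_trans ?_ (not_le.1 hd).le))
    exact Nat.cast_le.2 (Nat.sub_le _ _)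

/-- Radius 3R determines candidacy and b_v at nodes of `U`, and the competitors are at most R - 1
further away. -/
theorem IsLocal.greedyStep {S : ∀ I : PathInput.{u} n, Set I.V} {t : ℕ}
    (hS : IsLocal t fun I v => v ∈ S I)
    (hcov : ∀ I : PathInput.{u} n, ∀ x ∈ I.U, ∃ y ∈ S I, I.G.edist x y ≤ ((3 * R - 1 : ℕ) : ℕ∞)) :
    IsLocal (t + 4 * R) fun I v => v ∈ PathRulingSet.greedyStep I.G I.ℓ I.U R (S I) := by
  have hdist : ∀ ⦃I J : PathInput.{u} n⦄ ⦃v : I.V⦄ ⦃w : J.V⦄, v ∈ I.U → w ∈ J.U →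
      I.nodeView (t + 3 * R) v = J.nodeView (t + 3 * R) w →
      distTo I.G (S I) v = distTo J.G (S J) w := fun I J v w hv hw h =>
    (distTo_le_of_nodeView_eq hS hcov hv h.symm).antisymm (distTo_le_of_nodeView_eq hS hcov hw h)
  have hcand : ∀ ⦃I J : PathInput.{u} n⦄ ⦃v : I.V⦄ ⦃w : J.V⦄,
      I.nodeView (t + 3 * R) v = J.nodeView (t + 3 * R) w →
      v ∈ candidates I.G I.U R (S I) → w ∈ candidates J.G J.U R (S J) := fun I J v w h hv =>
    have hw := (mem_U_iff_of_nodeView_eq h).1 hv.1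
    ⟨hw, hdist hv.1 hw h ▸ hv.2⟩
  have key : ∀ ⦃I J : PathInput.{u} n⦄ ⦃v : I.V⦄ ⦃w : J.V⦄,
      I.nodeView (t + 4 * R) v = J.nodeView (t + 4 * R) w →
      v ∈ PathRulingSet.greedyStep I.G I.ℓ I.U R (S I) →
      w ∈ PathRulingSet.greedyStep J.G J.ℓ J.U R (S J) := by
    rintro I J v w h (hv | ⟨hv, hmax⟩)
    · exact Or.inl ((hS.mono (Nat.le_add_right _ _) h).mp hv)
    have h3 := nodeView_eq_of_le (show t + 3 * R ≤ t + 4 * R by omega) h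
    have hw := hcand h3 hv
    refine Or.inr ⟨hw, fun y hy hyw hd => ?_⟩
    obtain ⟨x, hx, he⟩ := exists_edist_le_of_nodeView_eq (t := t + 3 * R) (k := R - 1)
      (nodeView_eq_of_le (by omega) h.symm) hd
    have hxc := hcand he hy
    have hne : x ≠ v := by
      rintro rfl
      exact hyw (J.injective ((ℓ_eq_of_nodeView_eq he).trans (ℓ_eq_of_nodeView_eq h)))
    rw [hdist hy.1 hxc.1 he, hdist hw.1 hv.1 h3.symm, ℓ_eq_of_nodeView_eq he,
      ← ℓ_eq_of_nodeView_eq h]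
    exact hmax x hxc hne hx
  exact fun I J v w h => propext ⟨key h, key h.symm⟩

theorem IsLocal.greedyStep_iterate {S : ∀ I : PathInput.{u} n, Set I.V} {t : ℕ}
    (hS : IsLocal t fun I v => v ∈ S I)
    (hcov : ∀ I : PathInput.{u} n, ∀ x ∈ I.U, ∃ y ∈ S I, I.G.edist x y ≤ ((3 * R - 1 : ℕ) : ℕ∞))
    (k : ℕ) :
    IsLocal (t + k * (4 * R)) fun I v =>
      v ∈ (PathRulingSet.greedyStep I.G I.ℓ I.U R)^[k] (S I) := by
  induction k with
  | zero => simpa using hS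
  | succ k ih =>
    simp only [Function.iterate_succ_apply']
    rw [Nat.succ_mul, ← add_assoc]
    refine ih.greedyStep fun I x hx => ?_
    obtain ⟨y, hy, hd⟩ := hcov I x hx
    exact ⟨y, greedyStep_iterate_mono _ (Nat.zero_le k) hy, hd⟩

/-- The sets computed by the distributed execution of the first loop. -/
noncomputable def rulingChain (I : PathInput.{u} n) (R : ℕ) : ℕ → Set I.V
  | 0 => I.U
  | i + 1 => greedyMIS I.G (radius R (i + 1)) (rulingChain I R i)
      (reducedColouring I.G I.ℓ (radius R (i + 1)) (rulingChain I R i) (logStar n - 1)) 1025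

theorem isRulingChain_rulingChain (I : PathInput.{u} n) (R : ℕ) {k : ℕ} (hk : k ≤ depth R) :
    IsRulingChain I.G I.U R (I.rulingChain R) k := by
  obtain ⟨pos, hpos⟩ := I.isPathOrLine.exists_isometry_int
  induction k with
  | zero => exact ⟨rfl, fun i hi => absurd hi (Nat.not_lt_zero i)⟩
  | succ k ih =>
    have ih := ih (by omega)
    refine ⟨rfl, fun i hi => ?_⟩
    rcases Nat.lt_succ_iff_lt_or_eq.1 hi with hi | rfl
    · exact ih.2 i hi
    have hdeg : ∀ v ∈ I.rulingChain R i, ∃ a b,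
        powerNeighbors I.G (radius R (i + 1)) (I.rulingChain R i) v ⊆ {a, b} := by
      intro v hv
      refine powerNeighbors_subset_pair hpos (p := 2 ^ i) ?_
        (fun u hu v hv huv => ih.packing_of_lt_depth hk hu hv huv) hv
      have := radius_lt_two_pow hk
      rw [pow_succ] at this
      omega
    exact isLimitedRulingSet_greedyMIS
      (fun u hu v hv => reducedColouring_ne I.injective hdeg _ hu hv)
      (fun v hv => Nat.lt_succ_of_le (reducedColouring_le I.injective hdeg
        (fun v hv => I.le v (ih.subset hv)) v hv))

/-- Iteration k + 1 adds log* n - 1 reduction steps and 1025 greedy steps, each of radius below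
2^(k+1), so the cost at most doubles the bound reached so far. -/
theorem isLocal_rulingChain (n R : ℕ) {k : ℕ} (hk : k ≤ depth R) :
    IsLocal ((logStar n + 1024) * 2 ^ (k + 1)) fun (I : PathInput.{u} n) v =>
      v ∈ I.rulingChain R k := by
  induction k with
  | zero => exact fun I J v w h => propext (mem_U_iff_of_nodeView_eq h)
  | succ k ih =>
    have ih := ih (by omega)
    have hc := ih.reducedColouring (radius R (k + 1)) (logStar n - 1)
    refine ((ih.mono (Nat.le_add_right _ _)).greedyMIS (radius R (k + 1)) hc 1025).mono ?_
    have hr := (radius_lt_two_pow (R := R) (i := k) (by omega)).le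
    have hL : logStar n - 1 + 1025 = logStar n + 1024 := by
      unfold logStar
      omega
    calc _ = (logStar n + 1024) * 2 ^ (k + 1)
          + (logStar n - 1 + 1025) * radius R (k + 1) := by ring
      _ ≤ (logStar n + 1024) * 2 ^ (k + 1) + (logStar n + 1024) * 2 ^ (k + 1) := by
          rw [hL]
          gcongr
      _ = (logStar n + 1024) * 2 ^ (k + 1 + 1) := by ring

/-- The set computed by the distributed execution. -/
noncomputable def rulingSet (I : PathInput.{u} n) (R : ℕ) : Set I.V :=
  (PathRulingSet.greedyStep I.G I.ℓ I.U R)^[6] (I.rulingChain R (depth R))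

theorem isOutput_rulingSet (I : PathInput.{u} n) (R : ℕ) :
    IsOutput I.G I.ℓ I.U R (I.rulingSet R) :=
  isOutput_iff.2 ⟨_, I.isRulingChain_rulingChain R le_rfl, rfl⟩

theorem isLocal_rulingSet (n : ℕ) {R : ℕ} (hR : 1 ≤ R) :
    IsLocal (4124 * R * logStar n) fun (I : PathInput.{u} n) v => v ∈ I.rulingSet R := by
  refine ((isLocal_rulingChain n R le_rfl).greedyStep_iterate (R := R)
    (fun I x hx => (I.isRulingChain_rulingChain R le_rfl).covering hR hx) 6).mono ?_
  have hL : 1 ≤ logStar n := Nat.le_add_right _ _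
  -- With this bound the constant is 4 · 1025 for the first loop plus 6 · 4 for the greedy steps,
  -- that is 4124.
  have hpow : 2 ^ (depth R + 1) ≤ 4 * R := by
    rw [pow_succ]
    rcases Nat.lt_or_ge R 2 with h | h
    · have : depth R = 0 := Nat.clog_of_right_le_one (by omega) 2
      rw [this]
      omega
    · have := two_pow_depth_le h
      omega
  calc (logStar n + 1024) * 2 ^ (depth R + 1) + 6 * (4 * R)
      ≤ (logStar n + 1024 * logStar n) * (4 * R) + 6 * (4 * R) * logStar n := by
        refine add_le_add (Nat.mul_le_mul ?_ hpow) (Nat.le_mul_of_pos_right _ hL)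
        exact Nat.add_le_add_left (Nat.le_mul_of_pos_right _ hL) _
    _ = 4124 * R * logStar n := by ring

open Classical in
/-- The decision rule of a node after collecting information for `4124 * R * logStar n` rounds. -/
noncomputable def decision (n R : ℕ) (a : View (ℕ+ × Bool) (4124 * R * logStar n)) : Bool :=
  decide (∃ (I : PathInput.{u} n) (v : I.V), I.nodeView _ v = a ∧ v ∈ I.rulingSet R)

end PathInput

/-- PathRulingSet computes a `U`-limited `(R, R - 1)`-ruling set of a path or line `G`, whichever
maximal independent sets are chosen, and it can be executed in `O(R log* n)` rounds of
deterministic LOCAL when the nodes know `n` and `R` and the identifiers in `U` are at most `n`. -/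
theorem mainTheorem5 :
    (∀ (V : Type*) (G : SimpleGraph V) (ℓ : V → ℕ+) (U : Set V) (R : ℕ),
      IsPathOrLine G → Function.Injective ℓ → U.Finite → 1 ≤ R →
      ∀ S : Set V, PathRulingSet.IsOutput G ℓ U R S → IsLimitedRulingSet G U R (R - 1) S) ∧
    ∃ (C : ℕ) (A : ℕ → ℕ → LocalAlgorithm (ℕ+ × Bool) Bool),
      ∀ (n R : ℕ), 1 ≤ R →
      ∀ (V : Type*) (G : SimpleGraph V) [G.LocallyFinite] (ℓ : V → ℕ+) (U : Set V),
        IsPathOrLine G → Function.Injective ℓ → U.Finite → (∀ v ∈ U, (ℓ v : ℕ) ≤ n) →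
        ∃ S : Set V, PathRulingSet.IsOutput G ℓ U R S ∧
          IsLimitedRulingSet G U R (R - 1) S ∧
          (A n R).ComputesWithin G ℓ U S (C * R * logStar n) := by
  refine ⟨fun V G ℓ U R hG hℓ hU hR S hS => hS.isLimitedRulingSet hG hℓ hU hR,
    4124, fun n R => fullInformation _ (PathInput.decision n R), ?_⟩
  intro n R hR V G _ ℓ U hG hℓ hU hn
  let I : PathInput n := ⟨V, G, ℓ, U, hG, hℓ, hU, hn⟩
  have hout : PathRulingSet.IsOutput G ℓ U R (I.rulingSet R) := I.isOutput_rulingSet R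
  refine ⟨I.rulingSet R, hout, hout.isLimitedRulingSet hG hℓ hU hR, fun v => ?_⟩
  rw [output_run_fullInformation, PathInput.decision]
  congr 1
  rw [decide_eq_decide]
  constructor
  -- The decision rule accepts if some input with this view does; by locality all inputs with this
  -- view agree.
  · rintro ⟨J, w, hw, hmem⟩
    exact (PathInput.isLocal_rulingSet n hR (I := J) (J := I) hw).mp hmem
  · intro hv
    exact ⟨I, v, rfl, hv⟩
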